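/- Let $d,q,K\ge 1$ be integers. For $x\in\mathbb{R}^d$ and $s\in[K]=\{1,\dots,K\}$ consider the softmax-gated contaminated mixture of multinomial logistic experts $$p_G(s\mid x)=\frac{1}{1+e^{\beta^\top x+\tau}}\cdot\frac{e^{h_0(x,\eta_{0s})}}{\sum_{i=1}^K e^{h_0(x,\eta_{0i})}}+\frac{e^{\beta^\top x+\tau}}{1+e^{\beta^\top x+\tau}}\cdot\frac{e^{h(x,\eta_s)}}{\sum_{j=1}^K e^{h(x,\eta_j)}},\qquad G=(\beta,\tau,\eta)\in\mathbb{R}^d\times\mathbb{R}\times\mathbb{R}^{q\times K},$$ where the pre-trained expert $h_0$ and its parameter $\eta_0=(\eta_{01},\dots,\eta_{0K})\in\mathbb{R}^{q\times K}$ are fixed and known, and the expert functions $h_0,h:\mathbb{R}^d\times\mathbb{R}^q\to\mathbb{R}$ are measurable in $x$. Let $\mathcal{X}\subset\mathbb{R}^d$ be bounded, let $\Xi\subset\mathbb{R}^d\times\mathbb{R}\times\mathbb{R}^{q\times K}$ be compact, and let $L\ge 0$. Assume that the adapter expert $h$ is Lipschitz in its parameter over $\Xi$, uniformly in the covariate: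 $|h(x,\eta_i)-h(x,\eta_i')|\le L\|\eta_i-\eta_i'\|$ for all $x\in\mathcal{X}$, $i\in[K]$ and all $(\beta,\tau,\eta),(\beta',\tau',\eta')\in\Xi$. Let the covariate $X$ have a distribution $P_X$ supported in $\mathcal{X}$, and for $G_*\in\Xi$ let $(X_1,Y_1),\dots,(X_n,Y_n)$ be i.i.d. with $X_i\sim P_X$ and $Y_i\mid X_i=x\sim p_{G_*}(\cdot\mid x)$; write $\mathbb{E}_{p_{G_*,n}}$ for the expectation under their joint law, and $\mathbb{E}_X$ for the expectation over $X\sim P_X$ independent of the sample. Let $\widehat{G}_n$ be a maximum likelihood estimator, i.e. a measurable function of the sample with $$\widehat{G}_n\in\operatorname*{arg\,max}_{G\in\Xi}\ \sum_{i=1}^n\log p_G(Y_i\mid X_i).$$ For probability vectors $p,p'$ on $[K]$ let $d_H(p,p')=\bigl(\tfrac12\sum_{i=1}^K(\sqrt{p_i}-\sqrt{p'_i})^2\bigr)^{1/2}$ be the Hellinger distance. Then there is a constant $C>0$, depending only on $d,q,K,\Xi,\mathcal{X}$ and $L$ (in particular not on $n$, $G_*$, $P_X$ or the choice of the MLE),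 such that for every $n\ge 2$ $$\sup_{G_*\in\Xi}\ \mathbb{E}_{p_{G_*,n}}\Bigl[\mathbb{E}_X\bigl[d_H\bigl(p_{\widehat{G}_n}(\cdot\mid X),\,p_{G_*}(\cdot\mid X)\bigr)\bigr]\Bigr]\ \le\ C\,\Bigl(\frac{\log n}{n}\Bigr)^{1/2}.$$ -/

import Mathlib

open MeasureTheory
open scoped NNReal ENNReal

noncomputable section

namespace ContaminatedMoE

/-- Unknown parameters `G = (β, τ, η)` with `β ∈ ℝ^d`, `τ ∈ ℝ`, `η = (η₁, …, η_K) ∈ ℝ^{q × K}`. -/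
abbrev Param (d q K : ℕ) : Type :=
  EuclideanSpace ℝ (Fin d) × ℝ × (Fin K → EuclideanSpace ℝ (Fin q))

/-- `Softmax(v)_s = exp(v_s) / ∑_j exp(v_j)`. -/
def softmax {K : ℕ} (v : Fin K → ℝ) (s : Fin K) : ℝ :=
  Real.exp (v s) / ∑ j, Real.exp (v j)

/-- The conditional probability `p_G(y = s | x)` of the softmax-gated contaminated mixture of
multinomial logistic experts, with pre-trained expert function `h₀` and parameter `η₀`, and
adapter expert function `h`. -/
def condProb {d q K : ℕ} (h₀ h : EuclideanSpace ℝ (Fin d) → EuclideanSpace ℝ (Fin q) → ℝ)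
    (η₀ : Fin K → EuclideanSpace ℝ (Fin q)) (G : Param d q K)
    (x : EuclideanSpace ℝ (Fin d)) (s : Fin K) : ℝ :=
  1 / (1 + Real.exp (inner ℝ G.1 x + G.2.1)) * softmax (fun i => h₀ x (η₀ i)) s
    + Real.exp (inner ℝ G.1 x + G.2.1) / (1 + Real.exp (inner ℝ G.1 x + G.2.1))
      * softmax (fun i => h x (G.2.2 i)) s

/-- Law of one observation `(X, Y)`: `X ∼ P` and `Y | X = x` has mass function `p_G(· | x)`, i.e.
`(X, Y)` has density `p_G(y | x)` with respect to `P ⊗ counting measure`. -/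
def obsLaw {d q K : ℕ} (h₀ h : EuclideanSpace ℝ (Fin d) → EuclideanSpace ℝ (Fin q) → ℝ)
    (η₀ : Fin K → EuclideanSpace ℝ (Fin q)) (P : Measure (EuclideanSpace ℝ (Fin d)))
    (G : Param d q K) : Measure (EuclideanSpace ℝ (Fin d) × Fin K) :=
  (P.prod Measure.count).withDensity
    (fun z => ENNReal.ofReal (condProb h₀ h η₀ G z.1 z.2))

/-- The joint law of `n` i.i.d. observations under the parameter `G`. -/
def sampleLaw {d q K : ℕ} (h₀ h : EuclideanSpace ℝ (Fin d) → EuclideanSpace ℝ (Fin q) → ℝ)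
    (η₀ : Fin K → EuclideanSpace ℝ (Fin q)) (P : Measure (EuclideanSpace ℝ (Fin d)))
    (G : Param d q K) (n : ℕ) : Measure (Fin n → EuclideanSpace ℝ (Fin d) × Fin K) :=
  Measure.pi (fun _ => obsLaw h₀ h η₀ P G)

/-- The conditional log-likelihood `∑ᵢ log p_G(Yᵢ | Xᵢ)` of a sample. -/
def logLik {d q K : ℕ} (h₀ h : EuclideanSpace ℝ (Fin d) → EuclideanSpace ℝ (Fin q) → ℝ)
    (η₀ : Fin K → EuclideanSpace ℝ (Fin q)) {n : ℕ}
    (z : Fin n → EuclideanSpace ℝ (Fin d) × Fin K) (G : Param d q K) : ℝ :=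
  ∑ i, Real.log (condProb h₀ h η₀ G (z i).1 (z i).2)

/-- `Ghat` is a maximum likelihood estimator over `Ξ` based on `n` observations: a measurable
function of the sample which, for every sample with covariates in `𝒳`, takes its value in
`argmax_{G ∈ Ξ} ∑ᵢ log p_G(Yᵢ | Xᵢ)`. -/
def IsMLE {d q K : ℕ} (h₀ h : EuclideanSpace ℝ (Fin d) → EuclideanSpace ℝ (Fin q) → ℝ)
    (η₀ : Fin K → EuclideanSpace ℝ (Fin q)) (𝒳 : Set (EuclideanSpace ℝ (Fin d)))
    (Ξ : Set (Param d q K)) {n : ℕ}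
    (Ghat : (Fin n → EuclideanSpace ℝ (Fin d) × Fin K) → Param d q K) : Prop :=
  Measurable Ghat ∧
    ∀ z : Fin n → EuclideanSpace ℝ (Fin d) × Fin K, (∀ i, (z i).1 ∈ 𝒳) →
      Ghat z ∈ Ξ ∧ IsMaxOn (logLik h₀ h η₀ z) Ξ (Ghat z)

/-- Hellinger distance of two mass functions on `{1, …, K}`. -/
def hellinger {K : ℕ} (p q : Fin K → ℝ) : ℝ :=
  Real.sqrt (1 / 2 * ∑ i, |Real.sqrt (p i) - Real.sqrt (q i)| ^ 2)

end ContaminatedMoE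

end

section Covering

variable {E : Type*} [NormedAddCommGroup E] [NormedSpace ℝ E] [FiniteDimensional ℝ E]

theorem exists_finset_cover_closedBall (R : ℝ) (hR : 0 < R) :
    ∃ M : ℕ, 0 < M ∧ ∀ k : ℕ, ∃ T : Finset E, T.card ≤ M ^ k ∧
      ∀ x ∈ Metric.closedBall (0 : E) R, ∃ t ∈ T, dist x t ≤ R / 2 ^ k := by
  classical
  have := FiniteDimensional.proper ℝ E
  obtain ⟨t, -, htf, ht⟩ := (isCompact_closedBall (0 : E) 1).finite_cover_balls
    (e := 1 / 2) (by norm_num)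
  refine ⟨htf.toFinset.card, ?_, fun k => ?_⟩
  · have h0 : (0 : E) ∈ ⋃ x ∈ t, Metric.ball x (1 / 2) := ht (by simp)
    simp only [Set.mem_iUnion] at h0
    obtain ⟨y, hy, -⟩ := h0
    exact Finset.card_pos.2 ⟨y, by simpa using hy⟩
  induction k with
  | zero => exact ⟨{0}, by simp, fun x hx => ⟨0, by simp, by simpa using hx⟩⟩
  | succ k ih =>
    obtain ⟨T, hT, hcov⟩ := ih
    refine ⟨Finset.image₂ (fun a m => a + (R / 2 ^ k) • m) T htf.toFinset, ?_, ?_⟩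
    · exact (Finset.card_image₂_le _ _ _).trans (by rw [pow_succ]; gcongr)
    · intro x hx
      obtain ⟨a, ha, hxa⟩ := hcov x hx
      have hr : 0 < R / 2 ^ k := by positivity
      have hmem : (R / 2 ^ k)⁻¹ • (x - a) ∈ Metric.closedBall (0 : E) 1 := by
        rw [mem_closedBall_zero_iff, norm_smul, norm_inv, Real.norm_of_nonneg hr.le,
          ← dist_eq_norm, inv_mul_le_iff₀ hr]
        simpa using hxa
      have h1 := ht hmem
      simp only [Set.mem_iUnion] at h1
      obtain ⟨m, hm, hm'⟩ := h1
      refine ⟨a + (R / 2 ^ k) • m, Finset.mem_image₂_of_mem ha (by simpa using hm), ?_⟩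
      have heq : x - (a + (R / 2 ^ k) • m) = (R / 2 ^ k) • ((R / 2 ^ k)⁻¹ • (x - a) - m) := by
        rw [smul_sub, smul_inv_smul₀ hr.ne']; abel
      rw [dist_eq_norm, heq, norm_smul, Real.norm_of_nonneg hr.le, ← dist_eq_norm]
      calc R / 2 ^ k * _ ≤ R / 2 ^ k * (1 / 2) := by
            gcongr; exact (Metric.mem_ball.1 hm').le
        _ = R / 2 ^ (k + 1) := by rw [pow_succ]; field_simp

/-- Dyadic nets of a bounded set, consisting of points of the set, of polynomial size. -/
theorem Bornology.IsBounded.exists_finset_dyadic_net {Ξ : Set E} (hΞ : Bornology.IsBounded Ξ) :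
    ∃ R : ℝ, 0 < R ∧ ∃ M : ℕ, 0 < M ∧ ∀ k : ℕ, ∃ T : Finset E, (T : Set E) ⊆ Ξ ∧
      T.card ≤ M ^ k ∧ ∀ x ∈ Ξ, ∃ t ∈ T, dist x t ≤ R / 2 ^ k := by
  classical
  obtain ⟨R, hR, hsub⟩ := hΞ.subset_closedBall_lt 0 (0 : E)
  obtain ⟨M, hM, h⟩ := exists_finset_cover_closedBall (E := E) R hR
  refine ⟨2 * R, by positivity, M, hM, fun k => ?_⟩
  obtain ⟨T, hT, hcov⟩ := h k
  rcases Ξ.eq_empty_or_nonempty with rfl | ⟨x₀, hx₀⟩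
  · exact ⟨∅, by simp, by simp, by simp⟩
  have hch : ∀ t : E, ∃ y ∈ Ξ, ∀ x ∈ Ξ, dist x t ≤ R / 2 ^ k → dist y t ≤ R / 2 ^ k := by
    intro t
    by_cases ht : ∃ y ∈ Ξ, dist y t ≤ R / 2 ^ k
    · obtain ⟨y, hy, hyt⟩ := ht
      exact ⟨y, hy, fun _ _ _ => hyt⟩
    · push Not at ht
      exact ⟨x₀, hx₀, fun x hx hxt => absurd hxt (ht x hx).not_ge⟩
  choose f hf hf' using hch
  refine ⟨T.image f, ?_, Finset.card_image_le.trans hT, fun x hx => ?_⟩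
  · intro y hy
    obtain ⟨t, -, rfl⟩ := Finset.mem_image.1 (Finset.mem_coe.1 hy)
    exact hf t
  · obtain ⟨t, ht, hxt⟩ := hcov x (hsub hx)
    refine ⟨f t, Finset.mem_image_of_mem f ht, ?_⟩
    calc dist x (f t) ≤ dist x t + dist (f t) t := dist_triangle_right _ _ _
      _ ≤ R / 2 ^ k + R / 2 ^ k := add_le_add hxt (hf' t x hx hxt)
      _ = 2 * R / 2 ^ k := by ring

end Covering

namespace ContaminatedMoE

section Hellinger

variable {K : ℕ}

theorem hellinger_sq (p q : Fin K → ℝ) :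
    hellinger p q ^ 2 = 1 / 2 * ∑ i, (√(p i) - √(q i)) ^ 2 := by
  rw [hellinger, Real.sq_sqrt (by positivity)]
  simp only [sq_abs]

theorem hellinger_sq_eq_one_sub {p q : Fin K → ℝ} (hp : ∀ i, 0 ≤ p i) (hq : ∀ i, 0 ≤ q i)
    (hp1 : ∑ i, p i = 1) (hq1 : ∑ i, q i = 1) :
    hellinger p q ^ 2 = 1 - ∑ i, √(p i) * √(q i) := by
  have h : ∀ i, (√(p i) - √(q i)) ^ 2 = p i + q i - 2 * (√(p i) * √(q i)) := fun i => by
    rw [sub_sq, Real.sq_sqrt (hp i), Real.sq_sqrt (hq i)]; ring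
  rw [hellinger_sq, Finset.sum_congr rfl fun i _ => h i, Finset.sum_sub_distrib,
    Finset.sum_add_distrib, hp1, hq1, ← Finset.mul_sum]
  ring

theorem hellinger_sq_le_two_mul_add (p q r : Fin K → ℝ) :
    hellinger p r ^ 2 ≤ 2 * hellinger p q ^ 2 + 2 * hellinger q r ^ 2 := by
  have h : ∑ i, (√(p i) - √(r i)) ^ 2 ≤
      2 * ∑ i, (√(p i) - √(q i)) ^ 2 + 2 * ∑ i, (√(q i) - √(r i)) ^ 2 := by
    rw [Finset.mul_sum, Finset.mul_sum, ← Finset.sum_add_distrib]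
    exact Finset.sum_le_sum fun i _ => by
      nlinarith [sq_nonneg ((√(p i) - √(q i)) - (√(q i) - √(r i)))]
  simp only [hellinger_sq]
  linarith

theorem sqrt_sub_sqrt_le_of_le_exp_mul {a p q : ℝ}
    (h : p ≤ Real.exp a * q) : √p - √q ≤ a / 2 * √p := by
  have h1 : √p ≤ Real.exp (a / 2) * √q := by
    rw [Real.exp_half, ← Real.sqrt_mul (Real.exp_pos a).le]
    exact Real.sqrt_le_sqrt h
  have h2 : Real.exp (-(a / 2)) * √p ≤ √q := by
    rw [Real.exp_neg, inv_mul_le_iff₀ (Real.exp_pos _)]; exact h1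
  nlinarith [Real.add_one_le_exp (-(a / 2)), Real.sqrt_nonneg p]

theorem hellinger_sq_le_of_le_exp_mul {p q : Fin K → ℝ} {a : ℝ} (hp : ∀ i, 0 ≤ p i)
    (hq : ∀ i, 0 ≤ q i) (hp1 : ∑ i, p i = 1) (hq1 : ∑ i, q i = 1)
    (hpq : ∀ i, p i ≤ Real.exp a * q i) (hqp : ∀ i, q i ≤ Real.exp a * p i) :
    hellinger p q ^ 2 ≤ a ^ 2 / 4 := by
  have h : ∀ i, (√(p i) - √(q i)) ^ 2 ≤ a ^ 2 / 4 * (p i + q i) := fun i => by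
    have h1 := sqrt_sub_sqrt_le_of_le_exp_mul (hpq i)
    have h2 := sqrt_sub_sqrt_le_of_le_exp_mul (hqp i)
    have e1 : (a / 2 * √(p i)) ^ 2 = a ^ 2 / 4 * p i := by
      rw [mul_pow, Real.sq_sqrt (hp i)]; ring
    have e2 : (a / 2 * √(q i)) ^ 2 = a ^ 2 / 4 * q i := by
      rw [mul_pow, Real.sq_sqrt (hq i)]; ring
    have n1 : 0 ≤ a ^ 2 / 4 * p i := mul_nonneg (by positivity) (hp i)
    have n2 : 0 ≤ a ^ 2 / 4 * q i := mul_nonneg (by positivity) (hq i)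
    rcases le_total (√(q i)) (√(p i)) with h3 | h3
    · have := pow_le_pow_left₀ (sub_nonneg.2 h3) h1 2
      linarith
    · have := pow_le_pow_left₀ (sub_nonneg.2 h3) h2 2
      rw [sub_sq_comm]
      linarith
  have h' := Finset.sum_le_sum fun i (_ : i ∈ Finset.univ) => h i
  rw [← Finset.mul_sum, Finset.sum_add_distrib, hp1, hq1] at h'
  rw [hellinger_sq]
  linarith

end Hellinger

section CondProb

theorem softmax_pos {K : ℕ} (v : Fin K → ℝ) (s : Fin K) : 0 < softmax v s :=
  div_pos (Real.exp_pos _) (Finset.sum_pos (fun _ _ => Real.exp_pos _) ⟨s, Finset.mem_univ s⟩)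

theorem sum_softmax {K : ℕ} [NeZero K] (v : Fin K → ℝ) : ∑ s, softmax v s = 1 := by
  simp only [softmax]
  rw [← Finset.sum_div, div_self]
  exact (Finset.sum_pos (fun _ _ => Real.exp_pos _) Finset.univ_nonempty).ne'

theorem softmax_le_exp_mul {K : ℕ} {v w : Fin K → ℝ} {a : ℝ} (h : ∀ i, |v i - w i| ≤ a)
    (s : Fin K) : softmax v s ≤ Real.exp (2 * a) * softmax w s := by
  have hpos : ∀ u : Fin K → ℝ, 0 < ∑ j, Real.exp (u j) := fun u =>
    Finset.sum_pos (fun _ _ => Real.exp_pos _) ⟨s, Finset.mem_univ s⟩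
  have h1 : Real.exp (v s) ≤ Real.exp a * Real.exp (w s) := by
    rw [← Real.exp_add]; exact Real.exp_le_exp.2 (by linarith [(abs_le.1 (h s)).2])
  have h2 : ∑ j, Real.exp (w j) ≤ Real.exp a * ∑ j, Real.exp (v j) := by
    rw [Finset.mul_sum]
    refine Finset.sum_le_sum fun j _ => ?_
    rw [← Real.exp_add]; exact Real.exp_le_exp.2 (by linarith [(abs_le.1 (h j)).1])
  rw [softmax, softmax, ← mul_div_assoc, div_le_div_iff₀ (hpos v) (hpos w)]
  calc _ ≤ (Real.exp a * Real.exp (w s)) * (Real.exp a * ∑ j, Real.exp (v j)) := by gcongr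
    _ = _ := by rw [two_mul, Real.exp_add]; ring

theorem one_div_one_add_exp_le {t u b : ℝ} (h : |t - u| ≤ b) :
    1 / (1 + Real.exp t) ≤ Real.exp b * (1 / (1 + Real.exp u)) := by
  have h1 : Real.exp u ≤ Real.exp b * Real.exp t := by
    rw [← Real.exp_add]; exact Real.exp_le_exp.2 (by linarith [(abs_le.1 h).1])
  have h2 : 1 ≤ Real.exp b := Real.one_le_exp ((abs_nonneg _).trans h)
  rw [← mul_div_assoc, div_le_div_iff₀ (by positivity) (by positivity)]
  linarith

theorem exp_div_one_add_exp (t : ℝ) :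
    Real.exp t / (1 + Real.exp t) = 1 / (1 + Real.exp (-t)) := by
  rw [Real.exp_neg]; field_simp; ring

theorem exp_div_one_add_exp_le {t u b : ℝ} (h : |t - u| ≤ b) :
    Real.exp t / (1 + Real.exp t) ≤ Real.exp b * (Real.exp u / (1 + Real.exp u)) := by
  rw [exp_div_one_add_exp, exp_div_one_add_exp]
  exact one_div_one_add_exp_le (by rwa [neg_sub_neg, abs_sub_comm])

variable {d q K : ℕ} (h₀ h : EuclideanSpace ℝ (Fin d) → EuclideanSpace ℝ (Fin q) → ℝ)
    (η₀ : Fin K → EuclideanSpace ℝ (Fin q))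

theorem condProb_pos (G : Param d q K) (x : EuclideanSpace ℝ (Fin d)) (s : Fin K) :
    0 < condProb h₀ h η₀ G x s := by
  have := softmax_pos (fun i => h₀ x (η₀ i)) s
  have := softmax_pos (fun i => h x (G.2.2 i)) s
  unfold condProb
  positivity

theorem sum_condProb [NeZero K] (G : Param d q K) (x : EuclideanSpace ℝ (Fin d)) :
    ∑ s, condProb h₀ h η₀ G x s = 1 := by
  simp only [condProb]
  rw [Finset.sum_add_distrib, ← Finset.mul_sum, ← Finset.mul_sum, sum_softmax, sum_softmax]
  field_simp

theorem measurable_condProb (hh₀ : ∀ v, Measurable (fun x => h₀ x v))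
    (hh : ∀ v, Measurable (fun x => h x v)) (G : Param d q K) (s : Fin K) :
    Measurable fun x => condProb h₀ h η₀ G x s := by
  unfold condProb softmax
  have := fun i => hh₀ (η₀ i)
  have := fun i => hh (G.2.2 i)
  fun_prop

theorem measurable_condProb_prod (hh₀ : ∀ v, Measurable (fun x => h₀ x v))
    (hh : ∀ v, Measurable (fun x => h x v)) (G : Param d q K) :
    Measurable fun z : EuclideanSpace ℝ (Fin d) × Fin K => condProb h₀ h η₀ G z.1 z.2 :=
  measurable_from_prod_countable_left fun s => measurable_condProb h₀ h η₀ hh₀ hh G s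

/-- The log-probabilities are Lipschitz in the parameter, uniformly in a bounded covariate. -/
theorem condProb_le_exp_mul {Ξ : Set (Param d q K)} {L : ℝ≥0} {B : ℝ}
    {x : EuclideanSpace ℝ (Fin d)} (hx : ‖x‖ ≤ B)
    (hL : ∀ i, LipschitzOnWith L (h x) ((fun G => G.2.2 i) '' Ξ))
    {G G' : Param d q K} (hG : G ∈ Ξ) (hG' : G' ∈ Ξ) (s : Fin K) :
    condProb h₀ h η₀ G x s ≤
      Real.exp ((B + 1 + 2 * L) * dist G G') * condProb h₀ h η₀ G' x s := by
  set δ := dist G G' with hδ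
  have hδ0 : 0 ≤ δ := dist_nonneg
  have d1 : dist G.1 G'.1 ≤ δ := le_max_left _ _
  have d2 : dist G.2 G'.2 ≤ δ := le_max_right _ _
  have d3 : dist G.2.1 G'.2.1 ≤ δ := (le_max_left _ _).trans d2
  have d4 : ∀ i, dist (G.2.2 i) (G'.2.2 i) ≤ δ := fun i =>
    (dist_le_pi_dist _ _ i).trans ((le_max_right _ _).trans d2)
  have hgate : |(inner ℝ G.1 x + G.2.1) - (inner ℝ G'.1 x + G'.2.1)| ≤ (B + 1) * δ := by
    have e : (inner ℝ G.1 x + G.2.1) - (inner ℝ G'.1 x + G'.2.1)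
        = inner ℝ (G.1 - G'.1) x + (G.2.1 - G'.2.1) := by rw [inner_sub_left]; ring
    rw [e]
    calc _ ≤ |inner ℝ (G.1 - G'.1) x| + |G.2.1 - G'.2.1| := abs_add_le _ _
      _ ≤ δ * B + δ := by
        gcongr
        · refine (abs_real_inner_le_norm _ _).trans ?_
          rw [← dist_eq_norm]
          gcongr
        · exact d3
      _ = _ := by ring
  have hexp : ∀ i, |h x (G.2.2 i) - h x (G'.2.2 i)| ≤ L * δ := fun i =>
    ((hL i).dist_le_mul _ ⟨G, hG, rfl⟩ _ ⟨G', hG', rfl⟩).trans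
      (mul_le_mul_of_nonneg_left (d4 i) L.2)
  have s1 := one_div_one_add_exp_le hgate
  have s2 := exp_div_one_add_exp_le hgate
  have s3 := softmax_le_exp_mul hexp s
  have p0 := (softmax_pos (fun i => h₀ x (η₀ i)) s).le
  have p1 := (softmax_pos (fun i => h x (G.2.2 i)) s).le
  have p2 := (softmax_pos (fun i => h x (G'.2.2 i)) s).le
  have hle : Real.exp ((B + 1) * δ) ≤ Real.exp ((B + 1 + 2 * L) * δ) :=
    Real.exp_le_exp.2 (by nlinarith [mul_nonneg L.2 hδ0])
  have heq : Real.exp ((B + 1 + 2 * L) * δ)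
      = Real.exp ((B + 1) * δ) * Real.exp (2 * (L * δ)) := by
    rw [← Real.exp_add]; congr 1; ring
  unfold condProb
  rw [mul_add]
  refine add_le_add ?_ ?_
  · rw [← mul_assoc]
    exact mul_le_mul_of_nonneg_right (s1.trans (by gcongr)) p0
  · rw [heq]
    calc _ ≤ (Real.exp ((B + 1) * δ) * (Real.exp (inner ℝ G'.1 x + G'.2.1) /
          (1 + Real.exp (inner ℝ G'.1 x + G'.2.1)))) *
          (Real.exp (2 * (L * δ)) * softmax (fun i => h x (G'.2.2 i)) s) := by gcongr
      _ = _ := by ring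

end CondProb

end ContaminatedMoE

namespace ContaminatedMoE

section Likelihood

variable {d q K : ℕ} (h₀ h : EuclideanSpace ℝ (Fin d) → EuclideanSpace ℝ (Fin q) → ℝ)
    (η₀ : Fin K → EuclideanSpace ℝ (Fin q))

theorem lintegral_obsLaw (P : Measure (EuclideanSpace ℝ (Fin d))) [IsProbabilityMeasure P]
    (hh₀ : ∀ v, Measurable (fun x => h₀ x v)) (hh : ∀ v, Measurable (fun x => h x v))
    (G : Param d q K) {g : EuclideanSpace ℝ (Fin d) × Fin K → ℝ} (hg : Measurable g)
    (hg0 : ∀ z, 0 ≤ g z) :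
    ∫⁻ z, ENNReal.ofReal (g z) ∂obsLaw h₀ h η₀ P G =
      ∫⁻ x, ENNReal.ofReal (∑ s, condProb h₀ h η₀ G x s * g (x, s)) ∂P := by
  have hm := measurable_condProb_prod h₀ h η₀ hh₀ hh G
  rw [obsLaw, lintegral_withDensity_eq_lintegral_mul _ hm.ennreal_ofReal hg.ennreal_ofReal,
    lintegral_prod _ (hm.ennreal_ofReal.mul hg.ennreal_ofReal).aemeasurable]
  refine lintegral_congr fun x => ?_
  rw [lintegral_count, tsum_fintype, ENNReal.ofReal_sum_of_nonneg fun s _ =>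
    mul_nonneg (condProb_pos h₀ h η₀ G x s).le (hg0 _)]
  exact Finset.sum_congr rfl fun s _ =>
    (ENNReal.ofReal_mul (condProb_pos h₀ h η₀ G x s).le).symm

theorem isProbabilityMeasure_obsLaw [NeZero K] (P : Measure (EuclideanSpace ℝ (Fin d)))
    [IsProbabilityMeasure P]
    (hh₀ : ∀ v, Measurable (fun x => h₀ x v)) (hh : ∀ v, Measurable (fun x => h x v))
    (G : Param d q K) : IsProbabilityMeasure (obsLaw h₀ h η₀ P G) := by
  constructor
  have := lintegral_obsLaw h₀ h η₀ P hh₀ hh G (g := fun _ => 1) measurable_const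
    fun _ => zero_le_one
  simpa [sum_condProb] using this

/-- Root likelihood ratio of one observation. -/
noncomputable def rootRatio (G G' : Param d q K) (z : EuclideanSpace ℝ (Fin d) × Fin K) : ℝ :=
  √(condProb h₀ h η₀ G z.1 z.2) / √(condProb h₀ h η₀ G' z.1 z.2)

/-- Mean squared Hellinger distance of two conditional laws. -/
noncomputable def meanHellingerSq (P : Measure (EuclideanSpace ℝ (Fin d))) (G G' : Param d q K) : ℝ :=
  ∫ x, hellinger (condProb h₀ h η₀ G x) (condProb h₀ h η₀ G' x) ^ 2 ∂P

theorem rootRatio_pos (G G' : Param d q K) (z : EuclideanSpace ℝ (Fin d) × Fin K) :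
    0 < rootRatio h₀ h η₀ G G' z :=
  div_pos (Real.sqrt_pos.2 (condProb_pos ..)) (Real.sqrt_pos.2 (condProb_pos ..))

theorem rootRatio_eq_exp (G G' : Param d q K) (z : EuclideanSpace ℝ (Fin d) × Fin K) :
    rootRatio h₀ h η₀ G G' z = Real.exp ((Real.log (condProb h₀ h η₀ G z.1 z.2)
      - Real.log (condProb h₀ h η₀ G' z.1 z.2)) / 2) := by
  rw [rootRatio, Real.exp_half, Real.exp_sub, Real.exp_log (condProb_pos ..),
    Real.exp_log (condProb_pos ..), Real.sqrt_div (condProb_pos ..).le]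

theorem measurable_rootRatio (hh₀ : ∀ v, Measurable (fun x => h₀ x v))
    (hh : ∀ v, Measurable (fun x => h x v)) (G G' : Param d q K) :
    Measurable (rootRatio h₀ h η₀ G G') :=
  (measurable_condProb_prod h₀ h η₀ hh₀ hh G).sqrt.div
    (measurable_condProb_prod h₀ h η₀ hh₀ hh G').sqrt

theorem measurable_hellinger_sq (hh₀ : ∀ v, Measurable (fun x => h₀ x v))
    (hh : ∀ v, Measurable (fun x => h x v)) (G G' : Param d q K) :
    Measurable fun x => hellinger (condProb h₀ h η₀ G x) (condProb h₀ h η₀ G' x) ^ 2 := by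
  simp only [hellinger_sq]
  exact (Finset.measurable_sum _ fun s _ =>
    (((measurable_condProb h₀ h η₀ hh₀ hh G s).sqrt.sub
      (measurable_condProb h₀ h η₀ hh₀ hh G' s).sqrt).pow_const 2)).const_mul _

theorem hellinger_condProb_sq [NeZero K] (G G' : Param d q K) (x : EuclideanSpace ℝ (Fin d)) :
    hellinger (condProb h₀ h η₀ G x) (condProb h₀ h η₀ G' x) ^ 2 =
      1 - ∑ s, √(condProb h₀ h η₀ G x s) * √(condProb h₀ h η₀ G' x s) :=
  hellinger_sq_eq_one_sub (fun s => (condProb_pos h₀ h η₀ G x s).le)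
    (fun s => (condProb_pos h₀ h η₀ G' x s).le) (sum_condProb ..) (sum_condProb ..)

theorem hellinger_condProb_sq_le_one [NeZero K] (G G' : Param d q K)
    (x : EuclideanSpace ℝ (Fin d)) :
    hellinger (condProb h₀ h η₀ G x) (condProb h₀ h η₀ G' x) ^ 2 ≤ 1 := by
  rw [hellinger_condProb_sq]
  have : 0 ≤ ∑ s, √(condProb h₀ h η₀ G x s) * √(condProb h₀ h η₀ G' x s) := by positivity
  linarith

theorem integrable_hellinger_sq [NeZero K] (P : Measure (EuclideanSpace ℝ (Fin d)))
    [IsProbabilityMeasure P] (hh₀ : ∀ v, Measurable (fun x => h₀ x v))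
    (hh : ∀ v, Measurable (fun x => h x v)) (G G' : Param d q K) :
    Integrable (fun x => hellinger (condProb h₀ h η₀ G x) (condProb h₀ h η₀ G' x) ^ 2) P :=
  Integrable.of_bound (measurable_hellinger_sq h₀ h η₀ hh₀ hh G G').aestronglyMeasurable 1
    (ae_of_all _ fun x => by
      rw [Real.norm_of_nonneg (sq_nonneg _)]
      exact hellinger_condProb_sq_le_one h₀ h η₀ G G' x)

theorem lintegral_rootRatio_le [NeZero K] (P : Measure (EuclideanSpace ℝ (Fin d)))
    [IsProbabilityMeasure P] (hh₀ : ∀ v, Measurable (fun x => h₀ x v))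
    (hh : ∀ v, Measurable (fun x => h x v)) (G G' : Param d q K) :
    ∫⁻ z, ENNReal.ofReal (rootRatio h₀ h η₀ G G' z) ∂obsLaw h₀ h η₀ P G' ≤
      ENNReal.ofReal (Real.exp (-meanHellingerSq h₀ h η₀ P G G')) := by
  rw [lintegral_obsLaw h₀ h η₀ P hh₀ hh G' (measurable_rootRatio h₀ h η₀ hh₀ hh G G')
    fun z => (rootRatio_pos ..).le]
  have hint := integrable_hellinger_sq h₀ h η₀ P hh₀ hh G G'
  have heq : ∀ x, ∑ s, condProb h₀ h η₀ G' x s * rootRatio h₀ h η₀ G G' (x, s) =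
      1 - hellinger (condProb h₀ h η₀ G x) (condProb h₀ h η₀ G' x) ^ 2 := fun x => by
    rw [hellinger_condProb_sq, sub_sub_cancel]
    refine Finset.sum_congr rfl fun s _ => ?_
    have h1 := Real.sqrt_pos.2 (condProb_pos h₀ h η₀ G' x s)
    have h2 := Real.mul_self_sqrt (condProb_pos h₀ h η₀ G' x s).le
    simp only [rootRatio]
    rw [← mul_div_assoc, div_eq_iff h1.ne', mul_assoc, h2, mul_comm]
  simp only [heq]
  have hsub : Integrable (fun x =>
      1 - hellinger (condProb h₀ h η₀ G x) (condProb h₀ h η₀ G' x) ^ 2) P :=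
    (integrable_const _).sub hint
  rw [← ofReal_integral_eq_lintegral_ofReal hsub
    (ae_of_all _ fun x => sub_nonneg.2 (hellinger_condProb_sq_le_one h₀ h η₀ G G' x)),
    integral_sub (integrable_const _) hint]
  refine ENNReal.ofReal_le_ofReal ?_
  have := Real.add_one_le_exp (-meanHellingerSq h₀ h η₀ P G G')
  simp only [integral_const, probReal_univ, smul_eq_mul, mul_one]
  rw [meanHellingerSq] at *
  linarith

theorem lintegral_prod_rootRatio_le [NeZero K] (P : Measure (EuclideanSpace ℝ (Fin d)))
    [IsProbabilityMeasure P] (hh₀ : ∀ v, Measurable (fun x => h₀ x v))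
    (hh : ∀ v, Measurable (fun x => h x v)) (G G' : Param d q K) (n : ℕ) :
    ∫⁻ z, ENNReal.ofReal (Real.exp (n * meanHellingerSq h₀ h η₀ P G G') *
      ∏ i, rootRatio h₀ h η₀ G G' (z i)) ∂sampleLaw h₀ h η₀ P G' n ≤ 1 := by
  have := isProbabilityMeasure_obsLaw h₀ h η₀ P hh₀ hh G'
  have hm := (measurable_rootRatio h₀ h η₀ hh₀ hh G G').ennreal_ofReal
  have hind := ProbabilityTheory.iIndepFun_pi (ι := Fin n)
    (μ := fun _ => obsLaw h₀ h η₀ P G')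
    (X := fun _ z => ENNReal.ofReal (rootRatio h₀ h η₀ G G' z)) fun _ => hm.aemeasurable
  have hprod := ProbabilityTheory.lintegral_prod_eq_prod_lintegral_of_indepFun Finset.univ _ hind
    fun i => hm.comp (measurable_pi_apply i)
  have heval : ∀ i : Fin n, ∫⁻ z : Fin n → _, ENNReal.ofReal (rootRatio h₀ h η₀ G G' (z i))
      ∂Measure.pi (fun _ => obsLaw h₀ h η₀ P G') =
      ∫⁻ z, ENNReal.ofReal (rootRatio h₀ h η₀ G G' z) ∂obsLaw h₀ h η₀ P G' := fun i =>
    (measurePreserving_eval (fun _ : Fin n => obsLaw h₀ h η₀ P G') i).lintegral_comp hm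
  simp only [heval, Finset.prod_const, Finset.card_univ, Fintype.card_fin] at hprod
  simp only [ENNReal.ofReal_mul (Real.exp_pos _).le,
    ENNReal.ofReal_prod_of_nonneg fun i _ => (rootRatio_pos h₀ h η₀ G G' _).le]
  have hpm : Measurable fun z : Fin n → EuclideanSpace ℝ (Fin d) × Fin K =>
      ∏ i, ENNReal.ofReal (rootRatio h₀ h η₀ G G' (z i)) :=
    Finset.measurable_prod _ fun i _ => hm.comp (measurable_pi_apply i)
  rw [lintegral_const_mul _ hpm, sampleLaw, hprod]
  calc _ ≤ ENNReal.ofReal (Real.exp (n * meanHellingerSq h₀ h η₀ P G G')) *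
        ENNReal.ofReal (Real.exp (-meanHellingerSq h₀ h η₀ P G G')) ^ n := by
        gcongr
        exact lintegral_rootRatio_le h₀ h η₀ P hh₀ hh G G'
    _ = 1 := by
        rw [← ENNReal.ofReal_pow (Real.exp_pos _).le, ← ENNReal.ofReal_mul (Real.exp_pos _).le,
          ← Real.exp_nat_mul, ← Real.exp_add]
        simp

theorem ae_obsLaw_mem {P : Measure (EuclideanSpace ℝ (Fin d))} [IsProbabilityMeasure P]
    {𝒳 : Set (EuclideanSpace ℝ (Fin d))} (hP : ∀ᵐ x ∂P, x ∈ 𝒳) (G : Param d q K) :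
    ∀ᵐ z ∂obsLaw h₀ h η₀ P G, z.1 ∈ 𝒳 :=
  (withDensity_absolutelyContinuous _ _).ae_le
    (Measure.quasiMeasurePreserving_fst.ae hP)

theorem ae_sampleLaw_mem [NeZero K] {P : Measure (EuclideanSpace ℝ (Fin d))}
    [IsProbabilityMeasure P] {𝒳 : Set (EuclideanSpace ℝ (Fin d))} (hP : ∀ᵐ x ∂P, x ∈ 𝒳)
    (hh₀ : ∀ v, Measurable (fun x => h₀ x v)) (hh : ∀ v, Measurable (fun x => h x v))
    (G : Param d q K) (n : ℕ) :
    ∀ᵐ z ∂sampleLaw h₀ h η₀ P G n, ∀ i, (z i).1 ∈ 𝒳 := by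
  have := isProbabilityMeasure_obsLaw h₀ h η₀ P hh₀ hh G
  rw [ae_all_iff]
  exact fun i => (Measure.quasiMeasurePreserving_eval (fun _ => obsLaw h₀ h η₀ P G) i).ae
    (ae_obsLaw_mem h₀ h η₀ hP G)

end Likelihood

section Risk

variable {d q K : ℕ} (h₀ h : EuclideanSpace ℝ (Fin d) → EuclideanSpace ℝ (Fin q) → ℝ)
    (η₀ : Fin K → EuclideanSpace ℝ (Fin q))

/-- A parameter close to the maximiser has almost maximal likelihood ratio. -/
theorem one_le_exp_mul_prod_rootRatio {n : ℕ} {Ξ : Set (Param d q K)} {L : ℝ≥0} {B ε : ℝ}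
    {z : Fin n → EuclideanSpace ℝ (Fin d) × Fin K} (hz : ∀ i, ‖(z i).1‖ ≤ B)
    (hL : ∀ k, ∀ i, LipschitzOnWith L (h (z k).1) ((fun G => G.2.2 i) '' Ξ))
    (hB : 0 ≤ B) {G' Gm Gj : Param d q K} (hG' : G' ∈ Ξ) (hGm : Gm ∈ Ξ) (hGj : Gj ∈ Ξ)
    (hmax : IsMaxOn (logLik h₀ h η₀ z) Ξ Gm) (hdist : dist Gm Gj ≤ ε) :
    1 ≤ Real.exp (n * ((B + 1 + 2 * L) * ε) / 2) * ∏ i, rootRatio h₀ h η₀ Gj G' (z i) := by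
  have hlog : ∀ i, Real.log (condProb h₀ h η₀ Gm (z i).1 (z i).2) ≤
      (B + 1 + 2 * L) * ε + Real.log (condProb h₀ h η₀ Gj (z i).1 (z i).2) := fun i => by
    have h1 := condProb_le_exp_mul h₀ h η₀ (hz i) (hL i) hGm hGj (z i).2
    have h2 := Real.log_le_log (condProb_pos ..) h1
    rw [Real.log_mul (Real.exp_pos _).ne' (condProb_pos ..).ne', Real.log_exp] at h2
    have h3 : (B + 1 + 2 * L) * dist Gm Gj ≤ (B + 1 + 2 * L) * ε := by gcongr
    linarith
  have hsum := Finset.sum_le_sum fun i (_ : i ∈ Finset.univ) => hlog i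
  have hm : logLik h₀ h η₀ z G' ≤ logLik h₀ h η₀ z Gm := hmax hG'
  rw [Finset.sum_add_distrib, Finset.sum_const, Finset.card_univ, Fintype.card_fin,
    nsmul_eq_mul] at hsum
  rw [logLik, logLik] at hm
  simp only [rootRatio_eq_exp]
  rw [← Real.exp_sum, ← Real.exp_add, ← Finset.sum_div, Finset.sum_sub_distrib]
  exact Real.one_le_exp (by linarith)

theorem lintegral_hellinger_le [NeZero K] (P : Measure (EuclideanSpace ℝ (Fin d)))
    [IsProbabilityMeasure P] (hh₀ : ∀ v, Measurable (fun x => h₀ x v))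
    (hh : ∀ v, Measurable (fun x => h x v)) {𝒳 : Set (EuclideanSpace ℝ (Fin d))} {B : ℝ}
    (hB : 0 ≤ B) (h𝒳 : ∀ x ∈ 𝒳, ‖x‖ ≤ B) (hP : ∀ᵐ x ∂P, x ∈ 𝒳) {Ξ : Set (Param d q K)}
    {L : ℝ≥0} (hL : ∀ x ∈ 𝒳, ∀ i, LipschitzOnWith L (h x) ((fun G => G.2.2 i) '' Ξ))
    {G' Gm Gj : Param d q K} (hGm : Gm ∈ Ξ) (hGj : Gj ∈ Ξ)
    {ε : ℝ} (hdist : dist Gm Gj ≤ ε) {a : ℝ} (ha : 0 < a) :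
    ∫⁻ x, ENNReal.ofReal (hellinger (condProb h₀ h η₀ Gm x) (condProb h₀ h η₀ G' x)) ∂P ≤
      ENNReal.ofReal (a / 2 + (((B + 1 + 2 * L) * ε) ^ 2 / 4 +
        meanHellingerSq h₀ h η₀ P Gj G') / a) := by
  set b := (B + 1 + 2 * L) * ε
  have hint := integrable_hellinger_sq h₀ h η₀ P hh₀ hh Gj G'
  have hpt : ∀ x ∈ 𝒳, hellinger (condProb h₀ h η₀ Gm x) (condProb h₀ h η₀ G' x) ≤
      a / 2 + (b ^ 2 / 4 +
        hellinger (condProb h₀ h η₀ Gj x) (condProb h₀ h η₀ G' x) ^ 2) / a := fun x hx => by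
    have hle : Real.exp ((B + 1 + 2 * L) * dist Gm Gj) ≤ Real.exp b := by
      apply Real.exp_le_exp.2
      simp only [b]
      gcongr
    have h1 := hellinger_sq_le_of_le_exp_mul (a := b)
      (fun s => (condProb_pos h₀ h η₀ Gm x s).le) (fun s => (condProb_pos h₀ h η₀ Gj x s).le)
      (sum_condProb ..) (sum_condProb ..)
      (fun s => (condProb_le_exp_mul h₀ h η₀ (h𝒳 x hx) (hL x hx) hGm hGj s).trans
        (mul_le_mul_of_nonneg_right hle (condProb_pos ..).le))
      (fun s => (condProb_le_exp_mul h₀ h η₀ (h𝒳 x hx) (hL x hx) hGj hGm s).trans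
        (mul_le_mul_of_nonneg_right (by rwa [dist_comm]) (condProb_pos ..).le))
    have h2 := hellinger_sq_le_two_mul_add (condProb h₀ h η₀ Gm x) (condProb h₀ h η₀ Gj x)
      (condProb h₀ h η₀ G' x)
    set u := hellinger (condProb h₀ h η₀ Gm x) (condProb h₀ h η₀ G' x)
    have h3 : (b ^ 2 / 4 + hellinger (condProb h₀ h η₀ Gj x) (condProb h₀ h η₀ G' x) ^ 2) / a
        ≥ (u ^ 2 / 2) / a := by
      gcongr
      linarith
    have h4 : u - a / 2 ≤ (u ^ 2 / 2) / a := by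
      rw [le_div_iff₀ ha]
      nlinarith [sq_nonneg (u - a)]
    linarith
  calc _ ≤ ∫⁻ x, ENNReal.ofReal (a / 2 + (b ^ 2 / 4 +
        hellinger (condProb h₀ h η₀ Gj x) (condProb h₀ h η₀ G' x) ^ 2) / a) ∂P :=
        lintegral_mono_ae (hP.mono fun x hx => ENNReal.ofReal_le_ofReal (hpt x hx))
    _ = _ := by
        have hi1 : Integrable (fun x => b ^ 2 / 4 +
            hellinger (condProb h₀ h η₀ Gj x) (condProb h₀ h η₀ G' x) ^ 2) P :=
          (integrable_const _).add hint
        have hi2 : Integrable (fun x => a / 2 + (b ^ 2 / 4 +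
            hellinger (condProb h₀ h η₀ Gj x) (condProb h₀ h η₀ G' x) ^ 2) / a) P :=
          (integrable_const _).add (hi1.div_const a)
        rw [← ofReal_integral_eq_lintegral_ofReal hi2
          (ae_of_all _ fun x => by positivity)]
        rw [integral_add (integrable_const _) (hi1.div_const a),
          integral_div a fun x => b ^ 2 / 4 +
            hellinger (condProb h₀ h η₀ Gj x) (condProb h₀ h η₀ G' x) ^ 2,
          integral_add (integrable_const _) hint]
        simp [meanHellingerSq]

/-- Oracle bound for the maximum likelihood estimator in terms of a finite net `T`. -/
theorem lintegral_hellinger_mle_le [NeZero K] (P : Measure (EuclideanSpace ℝ (Fin d)))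
    [IsProbabilityMeasure P] (hh₀ : ∀ v, Measurable (fun x => h₀ x v))
    (hh : ∀ v, Measurable (fun x => h x v)) {𝒳 : Set (EuclideanSpace ℝ (Fin d))} {B : ℝ}
    (hB : 0 ≤ B) (h𝒳 : ∀ x ∈ 𝒳, ‖x‖ ≤ B) (hP : ∀ᵐ x ∂P, x ∈ 𝒳) {Ξ : Set (Param d q K)}
    {L : ℝ≥0} (hL : ∀ x ∈ 𝒳, ∀ i, LipschitzOnWith L (h x) ((fun G => G.2.2 i) '' Ξ))
    {T : Finset (Param d q K)} (hT : (T : Set (Param d q K)) ⊆ Ξ) {ε : ℝ} (hε : 0 ≤ ε)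
    (hcov : ∀ G ∈ Ξ, ∃ t ∈ T, dist G t ≤ ε) {N : ℝ} (hN : 1 ≤ N) (hTN : T.card ≤ N)
    {n : ℕ} (hn : 0 < n) {Ghat : (Fin n → EuclideanSpace ℝ (Fin d) × Fin K) → Param d q K}
    (hMLE : IsMLE h₀ h η₀ 𝒳 Ξ Ghat) {G' : Param d q K} (hG' : G' ∈ Ξ) {a : ℝ} (ha : 0 < a) :
    ∫⁻ z, ∫⁻ x, ENNReal.ofReal
        (hellinger (condProb h₀ h η₀ (Ghat z) x) (condProb h₀ h η₀ G' x)) ∂P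
        ∂sampleLaw h₀ h η₀ P G' n ≤
      ENNReal.ofReal (a / 2 + (((B + 1 + 2 * L) * ε) ^ 2 / 4 +
        (n * ((B + 1 + 2 * L) * ε) / 2 + Real.log N + 1) / n) / a) := by
  have hprob := isProbabilityMeasure_obsLaw h₀ h η₀ P hh₀ hh G'
  have hprob' : IsProbabilityMeasure (sampleLaw h₀ h η₀ P G' n) := by
    unfold sampleLaw; infer_instance
  have hn' : (0 : ℝ) < n := Nat.cast_pos.2 hn
  set b := (B + 1 + 2 * L) * ε with hb
  have hb0 : 0 ≤ b := by positivity
  have hN0 : 0 < N := by linarith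
  have hlogN := Real.log_nonneg hN
  set F : Param d q K → (Fin n → EuclideanSpace ℝ (Fin d) × Fin K) → ℝ := fun t z =>
    Real.exp (n * meanHellingerSq h₀ h η₀ P t G') * ∏ i, rootRatio h₀ h η₀ t G' (z i) with hF
  have hF0 : ∀ t z, 0 < F t z := fun t z =>
    mul_pos (Real.exp_pos _) (Finset.prod_pos fun i _ => rootRatio_pos ..)
  have hFm : ∀ t, Measurable (F t) := fun t =>
    (Finset.measurable_prod _ fun i _ =>
      (measurable_rootRatio h₀ h η₀ hh₀ hh t G').comp (measurable_pi_apply i)).const_mul _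
  have hS : ∫⁻ z, ENNReal.ofReal (∑ t ∈ T, F t z) ∂sampleLaw h₀ h η₀ P G' n ≤
      ENNReal.ofReal N := by
    simp only [ENNReal.ofReal_sum_of_nonneg fun t _ => (hF0 t _).le]
    rw [lintegral_finsetSum _ fun t _ => (hFm t).ennreal_ofReal]
    calc _ ≤ ∑ t ∈ T, (1 : ℝ≥0∞) := Finset.sum_le_sum fun t _ =>
          lintegral_prod_rootRatio_le h₀ h η₀ P hh₀ hh t G' n
      _ = ENNReal.ofReal T.card := by simp
      _ ≤ _ := ENNReal.ofReal_le_ofReal hTN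
  set A := a / 2 + (b ^ 2 / 4 + (n * b / 2 + Real.log N) / n) / a with hA
  have hA0 : 0 ≤ A := by positivity
  have hpt : ∀ z : Fin n → EuclideanSpace ℝ (Fin d) × Fin K, (∀ i, (z i).1 ∈ 𝒳) →
      ∫⁻ x, ENNReal.ofReal
        (hellinger (condProb h₀ h η₀ (Ghat z) x) (condProb h₀ h η₀ G' x)) ∂P ≤
      ENNReal.ofReal A + ENNReal.ofReal (1 / (n * a * N)) *
        ENNReal.ofReal (∑ t ∈ T, F t z) := by
    intro z hz
    obtain ⟨hGm, hmax⟩ := hMLE.2 z hz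
    obtain ⟨t, ht, hdist⟩ := hcov _ hGm
    have h1 := one_le_exp_mul_prod_rootRatio h₀ h η₀ (fun i => h𝒳 _ (hz i))
      (fun k => hL _ (hz k)) hB hG' hGm (hT ht) hmax hdist
    refine (lintegral_hellinger_le h₀ h η₀ P hh₀ hh hB h𝒳 hP hL (G' := G') hGm (hT ht)
      hdist ha).trans ?_
    rw [← ENNReal.ofReal_mul (by positivity), ← ENNReal.ofReal_add hA0
      (mul_nonneg (by positivity) (Finset.sum_nonneg fun t _ => (hF0 t z).le))]
    refine ENNReal.ofReal_le_ofReal ?_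
    set S := ∑ t ∈ T, F t z
    set H := meanHellingerSq h₀ h η₀ P t G'
    have hFS : F t z ≤ S := Finset.single_le_sum (f := fun t => F t z)
      (fun t _ => (hF0 t z).le) ht
    have hS0 : 0 < S := (hF0 t z).trans_le hFS
    have h2 : Real.exp (n * H) ≤ Real.exp (n * b / 2) * S := by
      calc _ ≤ Real.exp (n * H) * (Real.exp (n * b / 2) *
            ∏ i, rootRatio h₀ h η₀ t G' (z i)) := le_mul_of_one_le_right (Real.exp_pos _).le h1
        _ = Real.exp (n * b / 2) * F t z := by simp only [hF]; ring
        _ ≤ _ := by gcongr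
    have h3 : n * H ≤ n * b / 2 + Real.log S := by
      have := Real.log_le_log (Real.exp_pos _) h2
      rwa [Real.log_exp, Real.log_mul (Real.exp_pos _).ne' hS0.ne', Real.log_exp] at this
    have h4 : Real.log S ≤ Real.log N + S / N := by
      have := Real.log_le_sub_one_of_pos (div_pos hS0 hN0)
      rw [Real.log_div hS0.ne' hN0.ne'] at this
      linarith
    have h5 : H ≤ (n * b / 2 + Real.log N) / n + S / (n * N) := by
      have e : (n * b / 2 + Real.log N) / n + S / (n * N)
          = (n * b / 2 + Real.log N + S / N) / n := by field_simp
      rw [e, le_div_iff₀ hn']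
      linarith
    calc a / 2 + (b ^ 2 / 4 + H) / a
        ≤ a / 2 + (b ^ 2 / 4 + ((n * b / 2 + Real.log N) / n + S / (n * N))) / a := by gcongr
      _ = A + 1 / (n * a * N) * S := by rw [hA]; field_simp; ring
  calc _ ≤ ∫⁻ z, (ENNReal.ofReal A + ENNReal.ofReal (1 / (n * a * N)) *
        ENNReal.ofReal (∑ t ∈ T, F t z)) ∂sampleLaw h₀ h η₀ P G' n :=
        lintegral_mono_ae ((ae_sampleLaw_mem h₀ h η₀ hP hh₀ hh G' n).mono hpt)
    _ = ENNReal.ofReal A + ENNReal.ofReal (1 / (n * a * N)) *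
        ∫⁻ z, ENNReal.ofReal (∑ t ∈ T, F t z) ∂sampleLaw h₀ h η₀ P G' n := by
        rw [lintegral_add_left measurable_const, lintegral_const, measure_univ, mul_one,
          lintegral_const_mul _ (Finset.measurable_sum _ fun t _ => hFm t).ennreal_ofReal]
    _ ≤ ENNReal.ofReal A + ENNReal.ofReal (1 / (n * a * N)) * ENNReal.ofReal N := by gcongr
    _ = _ := by
        rw [← ENNReal.ofReal_mul (by positivity), ← ENNReal.ofReal_add hA0 (by positivity)]
        congr 1
        rw [hA]
        field_simp
        ring

end Risk

/-- The rate obtained from a net of size `M ^ k` and resolution `R / 2 ^ k` with `2 ^ k ≈ n`. -/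
theorem rate_bound {c R : ℝ} (hc : 0 ≤ c) (hR : 0 < R) {M k n : ℕ} (hn : 2 ≤ n)
    (hk : n ≤ 2 ^ k) (hk' : 2 ^ k ≤ 2 * n) :
    √(Real.log n / n) / 2 + ((c * (R / 2 ^ k)) ^ 2 / 4 +
        (n * (c * (R / 2 ^ k)) / 2 + Real.log ((M : ℝ) ^ k) + 1) / n) / √(Real.log n / n) ≤
      (1 / 2 + 2 * ((c * R) ^ 2 / 4 + c * R / 2 + 1) + 4 * Real.log M) *
        √(Real.log n / n) := by
  have hn2 : (2 : ℝ) ≤ n := by exact_mod_cast hn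
  have hn0 : (0 : ℝ) < n := by linarith
  have hlog2 : Real.log 2 ≤ Real.log n := Real.log_le_log (by norm_num) hn2
  have hl2 : 1 / 2 < Real.log 2 := by linarith [Real.log_two_gt_d9]
  set l := Real.log n
  have hl : 1 / 2 < l := by linarith
  set a := √(l / n) with ha
  have ha0 : 0 < a := Real.sqrt_pos.2 (by positivity)
  have ha2 : a ^ 2 = l / n := Real.sq_sqrt (by positivity)
  have hlogM : 0 ≤ Real.log M := Real.log_natCast_nonneg M
  have hkr : (n : ℝ) ≤ 2 ^ k := by exact_mod_cast hk
  have hkl : (k : ℝ) ≤ 4 * l := by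
    have h1 : Real.log ((2 : ℝ) ^ k) ≤ Real.log (2 * n) :=
      Real.log_le_log (by positivity) (by exact_mod_cast hk')
    rw [Real.log_pow, Real.log_mul (by norm_num) hn0.ne'] at h1
    have h2 : (0 : ℝ) ≤ k := Nat.cast_nonneg k
    nlinarith
  have hε : c * (R / 2 ^ k) ≤ c * R / n := by
    rw [mul_div_assoc]
    gcongr
  have hε0 : 0 ≤ c * (R / 2 ^ k) := by positivity
  set e := c * (R / 2 ^ k)
  have hcR : 0 ≤ c * R := by positivity
  have h1 : n * e ≤ c * R := by
    rw [le_div_iff₀ hn0] at hε; linarith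
  have h2 : n * e ^ 2 ≤ (c * R) ^ 2 := by
    have : (n * e) ^ 2 ≤ (c * R) ^ 2 := pow_le_pow_left₀ (by positivity) h1 2
    nlinarith [mul_nonneg (mul_nonneg hn0.le (sq_nonneg e)) (by linarith : (0 : ℝ) ≤ n - 1)]
  rw [Real.log_pow]
  have h3 : (e ^ 2 / 4 + (n * e / 2 + k * Real.log M + 1) / n) ≤
      (2 * ((c * R) ^ 2 / 4 + c * R / 2 + 1) + 4 * Real.log M) * a ^ 2 := by
    rw [ha2, ← mul_div_assoc, le_div_iff₀ hn0, add_mul, div_mul_cancel₀ _ hn0.ne']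
    have h4 : k * Real.log M ≤ 4 * l * Real.log M := by gcongr
    have h5 : 0 ≤ ((c * R) ^ 2 / 4 + c * R / 2 + 1) * (2 * l - 1) :=
      mul_nonneg (by positivity) (by linarith)
    nlinarith
  have h6 := div_le_div_of_nonneg_right h3 ha0.le
  have h7 : (2 * ((c * R) ^ 2 / 4 + c * R / 2 + 1) + 4 * Real.log M) * a ^ 2 / a
      = (2 * ((c * R) ^ 2 / 4 + c * R / 2 + 1) + 4 * Real.log M) * a := by
    field_simp
  linarith

end ContaminatedMoE

theorem proposition2 {d q K : ℕ}
    (𝒳 : Set (EuclideanSpace ℝ (Fin d))) (h𝒳 : Bornology.IsBounded 𝒳)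
    (Ξ : Set (ContaminatedMoE.Param d q K)) (hΞ : IsCompact Ξ) (L : ℝ≥0) :
    ∃ C : ℝ, 0 < C ∧
      ∀ (h₀ h : EuclideanSpace ℝ (Fin d) → EuclideanSpace ℝ (Fin q) → ℝ)
        (η₀ : Fin K → EuclideanSpace ℝ (Fin q))
        (P : Measure (EuclideanSpace ℝ (Fin d))) [IsProbabilityMeasure P],
        (∀ᵐ x ∂P, x ∈ 𝒳) →
        (∀ v, Measurable (fun x => h₀ x v)) →
        (∀ v, Measurable (fun x => h x v)) →
        (∀ x ∈ 𝒳, ∀ i, LipschitzOnWith L (h x) ((fun G => G.2.2 i) '' Ξ)) →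
        ∀ (n : ℕ), 2 ≤ n →
        ∀ Ghat : (Fin n → EuclideanSpace ℝ (Fin d) × Fin K) → ContaminatedMoE.Param d q K,
          ContaminatedMoE.IsMLE h₀ h η₀ 𝒳 Ξ Ghat →
          ⨆ G ∈ Ξ, ∫⁻ z, ∫⁻ x, ENNReal.ofReal
              (ContaminatedMoE.hellinger (ContaminatedMoE.condProb h₀ h η₀ (Ghat z) x)
                (ContaminatedMoE.condProb h₀ h η₀ G x)) ∂P
              ∂(ContaminatedMoE.sampleLaw h₀ h η₀ P G n)
            ≤ ENNReal.ofReal (C * Real.sqrt (Real.log n / n)) := by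
  obtain ⟨B, hB, hsub⟩ := h𝒳.subset_closedBall_lt 0 0
  obtain ⟨R, hR, M, hM, hnet⟩ := hΞ.isBounded.exists_finset_dyadic_net
  have hlogM : 0 ≤ Real.log M := Real.log_natCast_nonneg M
  refine ⟨1 / 2 + 2 * (((B + 1 + 2 * L) * R) ^ 2 / 4 + (B + 1 + 2 * L) * R / 2 + 1) +
    4 * Real.log M, by positivity, ?_⟩
  intro h₀ h η₀ P _ hP hh₀ hh hL n hn Ghat hMLE
  refine iSup₂_le fun G hG => ?_
  rcases Nat.eq_zero_or_pos K with rfl | hK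
  · simp [ContaminatedMoE.hellinger]
  have : NeZero K := ⟨hK.ne'⟩
  obtain ⟨k, hk, hk'⟩ := exists_nat_pow_near (by omega : 1 ≤ n) (by norm_num : 1 < 2)
  obtain ⟨T, hT, hcard, hcov⟩ := hnet (k + 1)
  have hn0 : (0 : ℝ) < n := by positivity
  have hlog : 0 < Real.log n := Real.log_pos (by exact_mod_cast hn)
  refine (ContaminatedMoE.lintegral_hellinger_mle_le h₀ h η₀ P hh₀ hh hB.le
    (fun x hx => by simpa using hsub hx) hP hL hT (by positivity) hcov
    (N := (M : ℝ) ^ (k + 1)) (one_le_pow₀ (by exact_mod_cast hM)) (by exact_mod_cast hcard)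
    (by omega) hMLE hG (Real.sqrt_pos.2 (div_pos hlog hn0))).trans ?_
  exact ENNReal.ofReal_le_ofReal (ContaminatedMoE.rate_bound (by positivity) hR hn hk'.le
    (by rw [pow_succ]; omega))
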